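/- Let $k$ be a field of characteristic $p\ge 0$. A quasi-Hopf algebra over $k$ is an associative unital $k$-algebra $H$ with algebra maps $\Delta:H\to H\otimes H$ and $\varepsilon:H\to k$, an invertible $\Phi=\sum X^1\otimes X^2\otimes X^3\in H\otimes H\otimes H$ with inverse $\Phi^{-1}=\sum x^1\otimes x^2\otimes x^3$, a $k$-linear unital algebra anti-endomorphism $S$ of $H$ (not assumed bijective) and elements $\alpha,\beta\in H$, such that for all $h\in H$, writing $\Delta(h)=\sum h_1\otimes h_2$, $$(\mathrm{id}\otimes\Delta)(\Delta(h))=\Phi\,(\Delta\otimes \mathrm{id})(\Delta(h))\,\Phi^{-1},\qquad (\mathrm{id}\otimes\varepsilon)(\Delta(h))=h=(\varepsilon\otimes \mathrm{id})(\Delta(h)),$$ $$(1\otimes\Phi)(\mathrm{id}\otimes\Delta\otimes \mathrm{id})(\Phi)(\Phi\otimes1)=(\mathrm{id}\otimes \mathrm{id}\otimes\Delta)(\Phi)(\Delta\otimes \mathrm{id}\otimes \mathrm{id})(\Phi),\qquad (\mathrm{id}\otimes\varepsilon\otimes \mathrm{id})(\Phi)=1\otimes1,$$ $$\sum S(h_1)\alpha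 h_2=\varepsilon(h)\alpha,\quad \sum h_1\beta S(h_2)=\varepsilon(h)\beta,\quad \sum X^1\beta S(X^2)\alpha X^3=1,\quad \sum S(x^1)\alpha x^2\beta S(x^3)=1.$$ It is called involutory if $S^2(h)=S(\beta)\alpha h\beta S(\alpha)$ for all $h\in H$. Theorem. Let $H$ be a finite-dimensional involutory quasi-Hopf algebra over $k$. If $H$ is not semisimple (as a ring), then $p$ divides $\dim_k P$ for every finite-dimensional projective left $H$-module $P$. (For $p=0$, divisibility by $p$ means $\dim_k P=0$.) -/

import Mathlib

open scoped TensorProduct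

/-- A quasi-bialgebra structure on the associative unital `k`-algebra `H`: algebra maps
`Δ : H → H ⊗ H` and `ε : H → k`, and an invertible element `Φ ∈ H ⊗ H ⊗ H` (the reassociator).
Triple and quadruple tensor powers are bracketed to the right, `H ⊗ (H ⊗ H)` and
`H ⊗ (H ⊗ (H ⊗ H))`; the algebra isomorphisms `Algebra.TensorProduct.assoc` only rebracket. -/
class QuasiBialgebra (k H : Type*) [Field k] [Ring H] [Algebra k H] where
  /-- The comultiplication `Δ`. -/
  comul : H →ₐ[k] H ⊗[k] H
  /-- The counit `ε`. -/
  counit : H →ₐ[k] k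
  /-- The reassociator `Φ`, an invertible element. -/
  reassoc : (H ⊗[k] (H ⊗[k] H))ˣ
  /-- `(id ⊗ Δ)(Δ(h)) = Φ (Δ ⊗ id)(Δ(h)) Φ⁻¹`. -/
  quasi_coassoc : ∀ h : H,
    Algebra.TensorProduct.map (AlgHom.id k H) comul (comul h) =
      (reassoc : H ⊗[k] (H ⊗[k] H)) *
        Algebra.TensorProduct.assoc k k k H H H
          (Algebra.TensorProduct.map comul (AlgHom.id k H) (comul h)) *
        ((reassoc⁻¹ : (H ⊗[k] (H ⊗[k] H))ˣ) : H ⊗[k] (H ⊗[k] H))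
  /-- `(id ⊗ ε)(Δ(h)) = h`. -/
  id_tensor_counit : ∀ h : H,
    Algebra.TensorProduct.rid k k H
      (Algebra.TensorProduct.map (AlgHom.id k H) counit (comul h)) = h
  /-- `(ε ⊗ id)(Δ(h)) = h`. -/
  counit_tensor_id : ∀ h : H,
    Algebra.TensorProduct.lid k H
      (Algebra.TensorProduct.map counit (AlgHom.id k H) (comul h)) = h
  /-- `(1 ⊗ Φ) (id ⊗ Δ ⊗ id)(Φ) (Φ ⊗ 1) = (id ⊗ id ⊗ Δ)(Φ) (Δ ⊗ id ⊗ id)(Φ)`. -/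
  cocycle :
    ((1 : H) ⊗ₜ[k] (reassoc : H ⊗[k] (H ⊗[k] H))) *
      Algebra.TensorProduct.map (AlgHom.id k H)
        ((Algebra.TensorProduct.assoc k k k H H H).toAlgHom.comp
          (Algebra.TensorProduct.map comul (AlgHom.id k H)))
        (reassoc : H ⊗[k] (H ⊗[k] H)) *
      Algebra.TensorProduct.map (AlgHom.id k H)
        (Algebra.TensorProduct.assoc k k k H H H).toAlgHom
        (Algebra.TensorProduct.assoc k k k H (H ⊗[k] H) H
          ((reassoc : H ⊗[k] (H ⊗[k] H)) ⊗ₜ[k] (1 : H))) =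
    Algebra.TensorProduct.map (AlgHom.id k H)
        (Algebra.TensorProduct.map (AlgHom.id k H) comul)
        (reassoc : H ⊗[k] (H ⊗[k] H)) *
      Algebra.TensorProduct.assoc k k k H H (H ⊗[k] H)
        (Algebra.TensorProduct.map comul (AlgHom.id k (H ⊗[k] H))
          (reassoc : H ⊗[k] (H ⊗[k] H)))
  /-- `(id ⊗ ε ⊗ id)(Φ) = 1 ⊗ 1`. -/
  counit_reassoc :
    Algebra.TensorProduct.map (AlgHom.id k H)
      ((Algebra.TensorProduct.lid k H).toAlgHom.comp
        (Algebra.TensorProduct.map counit (AlgHom.id k H)))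
      (reassoc : H ⊗[k] (H ⊗[k] H)) = (1 : H) ⊗ₜ[k] (1 : H)

/-- The linear map `H ⊗ H → H`, `x ⊗ y ↦ f(x) a g(y)`. -/
noncomputable def QuasiBialgebra.sandwich {k H : Type*} [Field k] [Ring H] [Algebra k H]
    (f : H →ₗ[k] H) (a : H) (g : H →ₗ[k] H) : H ⊗[k] H →ₗ[k] H :=
  TensorProduct.lift (((LinearMap.mul k H).comp ((LinearMap.mulRight k a).comp f)).compl₂ g)

/-- The linear map `H ⊗ (H ⊗ H) → H`, `x ⊗ (y ⊗ z) ↦ f(x) a (g(y) b h(z))`. -/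
noncomputable def QuasiBialgebra.sandwich₃ {k H : Type*} [Field k] [Ring H] [Algebra k H]
    (f : H →ₗ[k] H) (a : H) (g : H →ₗ[k] H) (b : H) (h : H →ₗ[k] H) :
    H ⊗[k] (H ⊗[k] H) →ₗ[k] H :=
  TensorProduct.lift
    (((LinearMap.mul k H).comp ((LinearMap.mulRight k a).comp f)).compl₂
      (QuasiBialgebra.sandwich g b h))

/-- A quasi-Hopf algebra structure on `H`: a quasi-bialgebra structure with an anti-endomorphism
`S` of the unital `k`-algebra `H` and elements `α, β ∈ H`. The antipode `S` is not
required to be bijective. -/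
class QuasiHopfAlgebra (k H : Type*) [Field k] [Ring H] [Algebra k H] extends
    QuasiBialgebra k H where
  /-- The antipode `S`. -/
  antipode : H →ₗ[k] H
  /-- The element `α`. -/
  α : H
  /-- The element `β`. -/
  β : H
  antipode_one : antipode 1 = 1
  antipode_mul : ∀ x y : H, antipode (x * y) = antipode y * antipode x
  /-- `S(h₁) α h₂ = ε(h) α`. -/
  antipode_alpha : ∀ h : H,
    QuasiBialgebra.sandwich antipode α LinearMap.id (comul h) = counit h • α
  /-- `h₁ β S(h₂) = ε(h) β`. -/
  beta_antipode : ∀ h : H,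
    QuasiBialgebra.sandwich LinearMap.id β antipode (comul h) = counit h • β
  /-- `X¹ β S(X²) α X³ = 1`, where `Φ = X¹ ⊗ X² ⊗ X³`. -/
  reassoc_antipode :
    QuasiBialgebra.sandwich₃ LinearMap.id β antipode α LinearMap.id
      (reassoc : H ⊗[k] (H ⊗[k] H)) = 1
  /-- `S(x¹) α x² β S(x³) = 1`, where `Φ⁻¹ = x¹ ⊗ x² ⊗ x³`. -/
  reassoc_inv_antipode :
    QuasiBialgebra.sandwich₃ antipode α LinearMap.id β antipode
      ((reassoc⁻¹ : (H ⊗[k] (H ⊗[k] H))ˣ) : H ⊗[k] (H ⊗[k] H)) = 1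

/-- `H` is involutory if `S²(h) = S(β) α h β S(α)` for all `h ∈ H`. -/
def QuasiHopfAlgebra.IsInvolutory (k H : Type*) [Field k] [Ring H] [Algebra k H]
    [QuasiHopfAlgebra k H] : Prop :=
  ∀ h : H, antipode (k := k) (antipode (k := k) h) =
    antipode (k := k) (β (k := k) : H) * α (k := k) * h * β (k := k) * antipode (k := k) (α (k := k) : H)

open QuasiBialgebra QuasiHopfAlgebra

/-! The proof produces a left integral `t` of `H` with `ε(t) = dim P` in `k`. If `dim P ≠ 0` in `k`,
then `t` rescales to a left integral with counit `1`, and Maschke's averaging argument makes `H`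
semisimple.

To obtain `t`, let `V = P*` with action `(h f)(x) = f(S(h) x)`. The element `z` of `P ⊗ V`
corresponding to the endomorphism `β` of `P` is invariant. Involutivity makes the twisted trace `g(x
⊗ f) = f(S(α) S(β) α x)` an `H`-linear map `P ⊗ V → k`, and `S(α) S(β) α β = 1` gives `g(z) = tr(id)
= dim P`. If `g` factors as `ε ∘ ψ` with `ψ : P ⊗ V → H` linear over `H`, then `t = ψ(z)` is the
required integral (`exists_integral_of_projective`).

Such a `ψ` exists because tensoring a projective module with `V` preserves the lifting property: an
`H`-map out of `P ⊗ V` is curried to an `H`-map `P → Hom(V, -)`, lifted by projectivity of `P`, and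
uncurried. Because of `Φ`, currying is corrected by `p = x¹ ⊗ x² β S(x³)` and uncurrying by `q = X¹
⊗ S(X²) α X³`. Only one composite of the two has to be the identity (`comulMul_pElem_qElem`). The
action on `Hom(V, M)` uses `S` and never its inverse, so bijectivity of `S` plays no role. -/

lemma mul_eq_of_mul_mul_eq {M : Type*} [Monoid M] {a b c d e c' d' : M}
    (h : a * b * c = d * e) (hc : c * c' = 1) (hd : d' * d = 1) : e * c' = d' * (a * b) := by
  rw [← one_mul e, ← hd, mul_assoc d', ← h, mul_assoc, mul_assoc, hc, mul_one]

lemma AlgHom.mul_eq_one_of_mul_eq_one {R A B : Type*} [CommSemiring R] [Semiring A] [Semiring B]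
    [Algebra R A] [Algebra R B] (f : A →ₐ[R] B) {x y : A} (h : x * y = 1) : f x * f y = 1 := by
  rw [← map_mul, h, map_one]

/-! ### Counit identities for the reassociator -/

namespace QuasiBialgebra

variable {k H : Type*} [Field k] [Ring H] [Algebra k H]

@[simp]
lemma sandwich_tmul (f : H →ₗ[k] H) (a : H) (g : H →ₗ[k] H) (x y : H) :
    sandwich f a g (x ⊗ₜ[k] y) = f x * a * g y := rfl

@[simp]
lemma sandwich₃_tmul (f : H →ₗ[k] H) (a : H) (g : H →ₗ[k] H) (b : H) (h : H →ₗ[k] H)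
    (x : H) (w : H ⊗[k] H) :
    sandwich₃ f a g b h (x ⊗ₜ[k] w) = f x * a * sandwich g b h w := rfl

/-- The inclusion `y ↦ y ⊗ 1`. -/
noncomputable def tmulOne : H ⊗[k] (H ⊗[k] H) →ₐ[k] H ⊗[k] (H ⊗[k] (H ⊗[k] H)) :=
  ((Algebra.TensorProduct.map (AlgHom.id k H)
        (Algebra.TensorProduct.assoc k k k H H H).toAlgHom).comp
        (Algebra.TensorProduct.assoc k k k H (H ⊗[k] H) H).toAlgHom).comp
    Algebra.TensorProduct.includeLeft

lemma tmulOne_tmul (a b c : H) :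
    tmulOne (a ⊗ₜ[k] (b ⊗ₜ[k] c)) = a ⊗ₜ[k] (b ⊗ₜ[k] (c ⊗ₜ[k] (1 : H))) := by
  simp [tmulOne]

variable [QuasiBialgebra k H]

variable (k H) in
/-- The algebra map `id ⊗ id ⊗ ε`. -/
noncomputable def counitRight : H ⊗[k] (H ⊗[k] H) →ₐ[k] H ⊗[k] H :=
  Algebra.TensorProduct.map (AlgHom.id k H)
    ((Algebra.TensorProduct.rid k k H).toAlgHom.comp
      (Algebra.TensorProduct.map (AlgHom.id k H) counit))

@[simp]
lemma counitRight_tmul (x y z : H) :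
    counitRight k H (x ⊗ₜ (y ⊗ₜ z)) = counit (k := k) z • (x ⊗ₜ[k] y) := by
  simp [counitRight]

variable (k H) in
/-- The algebra map `id ⊗ id ⊗ ε ⊗ id`. -/
noncomputable def counitThird : H ⊗[k] (H ⊗[k] (H ⊗[k] H)) →ₐ[k] H ⊗[k] (H ⊗[k] H) :=
  Algebra.TensorProduct.map (AlgHom.id k H)
    (Algebra.TensorProduct.map (AlgHom.id k H)
      ((Algebra.TensorProduct.lid k H).toAlgHom.comp
        (Algebra.TensorProduct.map counit (AlgHom.id k H))))

@[simp]
lemma counitThird_tmul (x y z w : H) :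
    counitThird k H (x ⊗ₜ (y ⊗ₜ (z ⊗ₜ w))) = counit (k := k) z • (x ⊗ₜ[k] (y ⊗ₜ[k] w)) := by
  simp [counitThird]

lemma counitThird_one_tmul (y : H ⊗[k] (H ⊗[k] H)) :
    counitThird k H (1 ⊗ₜ y) = 1 ⊗ₜ[k] Algebra.TensorProduct.map (AlgHom.id k H)
      ((Algebra.TensorProduct.lid k H).toAlgHom.comp
        (Algebra.TensorProduct.map counit (AlgHom.id k H))) y := by
  simp [counitThird]

lemma counitThird_comul_middle (y : H ⊗[k] (H ⊗[k] H)) :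
    counitThird k H (Algebra.TensorProduct.map (AlgHom.id k H)
      ((Algebra.TensorProduct.assoc k k k H H H).toAlgHom.comp
        (Algebra.TensorProduct.map comul (AlgHom.id k H))) y) = y := by
  induction y using TensorProduct.induction_on with
  | zero => simp only [map_zero]
  | add x y hx hy => simp only [map_add, hx, hy]
  | tmul a y =>
  induction y using TensorProduct.induction_on with
  | zero => simp only [TensorProduct.tmul_zero, map_zero]
  | add x y hx hy => simp only [TensorProduct.tmul_add, map_add, hx, hy]
  | tmul b c =>
    have key : ∀ d : H ⊗[k] H, counitThird k H (a ⊗ₜ (Algebra.TensorProduct.assoc k k k H H H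
        (d ⊗ₜ c))) = a ⊗ₜ (Algebra.TensorProduct.rid k k H
          (Algebra.TensorProduct.map (AlgHom.id k H) counit d) ⊗ₜ c) := by
      intro d
      induction d using TensorProduct.induction_on with
      | zero => simp
      | add x y hx hy =>
        simp only [TensorProduct.tmul_add, TensorProduct.add_tmul, map_add, hx, hy]
      | tmul x y => simp [← TensorProduct.smul_tmul']
    simpa [id_tensor_counit] using key (comul b)

lemma counitThird_tmul_one (y : H ⊗[k] (H ⊗[k] H)) :
    counitThird k H (Algebra.TensorProduct.map (AlgHom.id k H)
        (Algebra.TensorProduct.assoc k k k H H H).toAlgHom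
        (Algebra.TensorProduct.assoc k k k H (H ⊗[k] H) H (y ⊗ₜ[k] (1 : H)))) =
      Algebra.TensorProduct.assoc k k k H H H (counitRight k H y ⊗ₜ 1) := by
  induction y using TensorProduct.induction_on with
  | zero => simp only [TensorProduct.zero_tmul, map_zero]
  | add x y hx hy => simp only [TensorProduct.add_tmul, map_add, hx, hy]
  | tmul a y =>
  induction y using TensorProduct.induction_on with
  | zero => simp only [TensorProduct.tmul_zero, TensorProduct.zero_tmul, map_zero]
  | add x y hx hy =>
    simp only [TensorProduct.tmul_add, TensorProduct.add_tmul, map_add, hx, hy]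
  | tmul b c => simp [← TensorProduct.smul_tmul']

lemma counitThird_comul_right (y : H ⊗[k] (H ⊗[k] H)) :
    counitThird k H (Algebra.TensorProduct.map (AlgHom.id k H)
        (Algebra.TensorProduct.map (AlgHom.id k H) comul) y) = y := by
  induction y using TensorProduct.induction_on with
  | zero => simp only [map_zero]
  | add x y hx hy => simp only [map_add, hx, hy]
  | tmul a y =>
  induction y using TensorProduct.induction_on with
  | zero => simp only [TensorProduct.tmul_zero, map_zero]
  | add x y hx hy => simp only [TensorProduct.tmul_add, map_add, hx, hy]
  | tmul b c =>
    simp [counitThird, counit_tensor_id]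

lemma counitThird_comul_left (y : H ⊗[k] (H ⊗[k] H)) :
    counitThird k H (Algebra.TensorProduct.assoc k k k H H (H ⊗[k] H)
        (Algebra.TensorProduct.map comul (AlgHom.id k (H ⊗[k] H)) y)) =
      Algebra.TensorProduct.assoc k k k H H H (Algebra.TensorProduct.map comul (AlgHom.id k H)
        (Algebra.TensorProduct.map (AlgHom.id k H)
          ((Algebra.TensorProduct.lid k H).toAlgHom.comp
            (Algebra.TensorProduct.map counit (AlgHom.id k H))) y)) := by
  induction y using TensorProduct.induction_on with
  | zero => simp only [map_zero]
  | add x y hx hy => simp only [map_add, hx, hy]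
  | tmul a y =>
  induction y using TensorProduct.induction_on with
  | zero => simp only [TensorProduct.tmul_zero, map_zero]
  | add x y hx hy => simp only [TensorProduct.tmul_add, map_add, hx, hy]
  | tmul b c =>
    have key : ∀ d : H ⊗[k] H, counitThird k H (Algebra.TensorProduct.assoc k k k H H (H ⊗[k] H)
        (d ⊗ₜ (b ⊗ₜ c))) =
        Algebra.TensorProduct.assoc k k k H H H (d ⊗ₜ (counit (k := k) b • c)) := by
      intro d
      induction d using TensorProduct.induction_on with
      | zero => simp
      | add x y hx hy => simp only [TensorProduct.add_tmul, map_add, hx, hy]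
      | tmul x y => simp
    simpa using key (comul a)

/-- `(id ⊗ id ⊗ ε)(Φ) = 1 ⊗ 1`. -/
lemma counitRight_reassoc :
    counitRight k H (reassoc : (H ⊗[k] (H ⊗[k] H))ˣ) = 1 := by
  -- Under `id ⊗ id ⊗ ε ⊗ id` the cocycle identity collapses to `Φ ((id ⊗ id ⊗ ε)(Φ) ⊗ 1) = Φ`, and
  -- `Φ` cancels.
  have h := congrArg (counitThird k H) (cocycle (k := k) (H := H))
  rw [map_mul, map_mul, map_mul, counitThird_one_tmul, counitThird_comul_middle,
    counitThird_tmul_one, counitThird_comul_right, counitThird_comul_left, counit_reassoc,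
    ← Algebra.TensorProduct.one_def, map_one, map_one, ← Algebra.TensorProduct.one_def, one_mul,
    Units.mul_right_inj, EmbeddingLike.map_eq_one_iff] at h
  have h' := congrArg (Algebra.TensorProduct.rid k k (H ⊗[k] H))
    (congrArg (Algebra.TensorProduct.map (AlgHom.id k (H ⊗[k] H)) (counit (k := k) (H := H))) h)
  simpa using h'

lemma counitRight_reassoc_inv :
    counitRight k H ((reassoc⁻¹ : (H ⊗[k] (H ⊗[k] H))ˣ) : H ⊗[k] (H ⊗[k] H)) = 1 := by
  have h : counitRight k H
      ((reassoc : (H ⊗[k] (H ⊗[k] H))ˣ) * ((reassoc⁻¹ : (H ⊗[k] (H ⊗[k] H))ˣ))) = 1 := by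
    rw [Units.mul_inv, map_one]
  rwa [map_mul, counitRight_reassoc, one_mul] at h

end QuasiBialgebra

/-! ### The elements p and q -/

namespace QuasiHopfAlgebra

variable {k H : Type*} [Field k] [Ring H] [Algebra k H] [QuasiHopfAlgebra k H]

lemma sandwich_beta_tmul_mul (w : H ⊗[k] H) (c d : H) :
    sandwich LinearMap.id (β k) antipode ((c ⊗ₜ d) * w) =
      c * sandwich LinearMap.id (β k) antipode w * antipode (k := k) d := by
  induction w using TensorProduct.induction_on with
  | zero => simp
  | add u v hu hv => simp only [map_add, add_mul, mul_add, hu, hv]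
  | tmul u v => simp [antipode_mul, mul_assoc]

lemma sandwich_beta_mul_comul (z : H ⊗[k] H) (h : H) :
    sandwich LinearMap.id (β k) antipode (z * comul h) =
      counit (k := k) h • sandwich LinearMap.id (β k) antipode z := by
  induction z using TensorProduct.induction_on with
  | zero => simp
  | add x y hx hy => simp only [map_add, add_mul, smul_add, hx, hy]
  | tmul x y => simp [sandwich_beta_tmul_mul, beta_antipode]

lemma sandwich_alpha_mul_tmul (w : H ⊗[k] H) (c d : H) :
    sandwich antipode (α k) LinearMap.id (w * (c ⊗ₜ d)) =
      antipode (k := k) c * sandwich antipode (α k) LinearMap.id w * d := by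
  induction w using TensorProduct.induction_on with
  | zero => simp
  | add u v hu hv => simp only [map_add, add_mul, mul_add, hu, hv]
  | tmul u v => simp [antipode_mul, mul_assoc]

lemma sandwich_alpha_comul_mul (z : H ⊗[k] H) (h : H) :
    sandwich antipode (α k) LinearMap.id (comul h * z) =
      counit (k := k) h • sandwich antipode (α k) LinearMap.id z := by
  induction z using TensorProduct.induction_on with
  | zero => simp
  | add x y hx hy => simp only [map_add, mul_add, smul_add, hx, hy]
  | tmul x y => simp [sandwich_alpha_mul_tmul, antipode_alpha]

variable (k H) in
/-- The map `a ⊗ b ⊗ c ↦ a ⊗ b β S(c)`. -/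
noncomputable def betaRight : H ⊗[k] (H ⊗[k] H) →ₗ[k] H ⊗[k] H :=
  LinearMap.lTensor H (sandwich LinearMap.id (β k) antipode)

variable (k H) in
/-- The map `a ⊗ b ⊗ c ↦ a ⊗ S(b) α c`. -/
noncomputable def alphaRight : H ⊗[k] (H ⊗[k] H) →ₗ[k] H ⊗[k] H :=
  LinearMap.lTensor H (sandwich antipode (α k) LinearMap.id)

variable (k H) in
/-- The map `a ⊗ b ⊗ c ⊗ d ↦ a ⊗ b β S(c) α d`. -/
noncomputable def betaAlphaRight : H ⊗[k] (H ⊗[k] (H ⊗[k] H)) →ₗ[k] H ⊗[k] H :=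
  LinearMap.lTensor H (sandwich₃ LinearMap.id (β k) antipode (α k) LinearMap.id)

@[simp]
lemma betaRight_tmul (a : H) (w : H ⊗[k] H) :
    betaRight k H (a ⊗ₜ w) = a ⊗ₜ sandwich LinearMap.id (β k) antipode w := rfl

@[simp]
lemma alphaRight_tmul (a : H) (w : H ⊗[k] H) :
    alphaRight k H (a ⊗ₜ w) = a ⊗ₜ sandwich antipode (α k) LinearMap.id w := rfl

@[simp]
lemma betaAlphaRight_tmul (a : H) (w : H ⊗[k] (H ⊗[k] H)) :
    betaAlphaRight k H (a ⊗ₜ w) =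
      a ⊗ₜ sandwich₃ LinearMap.id (β k) antipode (α k) LinearMap.id w := rfl

lemma betaRight_assoc_mul (d : H ⊗[k] H) (c : H) (y : H ⊗[k] (H ⊗[k] H)) :
    betaRight k H (Algebra.TensorProduct.assoc k k k H H H (d ⊗ₜ c) * y) =
      d * betaRight k H y * (1 ⊗ₜ antipode (k := k) c) := by
  induction d using TensorProduct.induction_on with
  | zero => simp
  | add u v hu hv => simp only [TensorProduct.add_tmul, map_add, add_mul, hu, hv]
  | tmul d e =>
  induction y using TensorProduct.induction_on with
  | zero => simp
  | add u v hu hv => simp only [map_add, add_mul, mul_add, hu, hv]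
  | tmul a w => simp [sandwich_beta_tmul_mul]

lemma betaRight_mul_comul (y : H ⊗[k] (H ⊗[k] H)) (w : H ⊗[k] H) :
    betaRight k H (y * Algebra.TensorProduct.map (AlgHom.id k H) comul w) =
      betaRight k H y * (Algebra.TensorProduct.rid k k H
        (Algebra.TensorProduct.map (AlgHom.id k H) counit w) ⊗ₜ 1) := by
  induction w using TensorProduct.induction_on with
  | zero => simp
  | add u v hu hv => simp only [TensorProduct.add_tmul, map_add, mul_add, hu, hv]
  | tmul d e =>
  induction y using TensorProduct.induction_on with
  | zero => simp
  | add u v hu hv => simp only [map_add, add_mul, hu, hv]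
  | tmul a w => simp [sandwich_beta_mul_comul, TensorProduct.tmul_smul, TensorProduct.smul_tmul']

lemma alphaRight_comul_mul (y : H ⊗[k] (H ⊗[k] H)) (w : H ⊗[k] H) :
    alphaRight k H (Algebra.TensorProduct.map (AlgHom.id k H) comul w * y) =
      (Algebra.TensorProduct.rid k k H
        (Algebra.TensorProduct.map (AlgHom.id k H) counit w) ⊗ₜ 1) * alphaRight k H y := by
  induction w using TensorProduct.induction_on with
  | zero => simp
  | add u v hu hv => simp only [TensorProduct.add_tmul, map_add, add_mul, hu, hv]
  | tmul d e =>
  induction y using TensorProduct.induction_on with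
  | zero => simp
  | add u v hu hv => simp only [map_add, mul_add, hu, hv]
  | tmul a w => simp [sandwich_alpha_comul_mul, TensorProduct.tmul_smul, TensorProduct.smul_tmul']

variable (k H) in
/-- The element `x¹ ⊗ x² β S(x³)`, where `Φ⁻¹ = x¹ ⊗ x² ⊗ x³`. -/
noncomputable def pElem : H ⊗[k] H :=
  betaRight k H ((reassoc⁻¹ : (H ⊗[k] (H ⊗[k] H))ˣ) : H ⊗[k] (H ⊗[k] H))

variable (k H) in
/-- The element `X¹ ⊗ S(X²) α X³`, where `Φ = X¹ ⊗ X² ⊗ X³`. -/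
noncomputable def qElem : H ⊗[k] H :=
  alphaRight k H (reassoc : (H ⊗[k] (H ⊗[k] H))ˣ)

/-- The map `a ⊗ b ↦ Δ(a) t (1 ⊗ b)`. -/
noncomputable def comulMul (t : H ⊗[k] H) : H ⊗[k] H →ₗ[k] H ⊗[k] H :=
  TensorProduct.lift (((LinearMap.mul k (H ⊗[k] H)).comp
    ((LinearMap.mulRight k t).comp (comul (k := k) (H := H)).toLinearMap)).compl₂
      (TensorProduct.mk k H H 1))

@[simp]
lemma comulMul_tmul (t : H ⊗[k] H) (a b : H) :
    comulMul t (a ⊗ₜ b) = comul a * t * (1 ⊗ₜ b) := rfl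

/-- `Δ(h₁) p (1 ⊗ S(h₂)) = p (h ⊗ 1)`. -/
lemma comulMul_pElem (h : H) :
    comulMul (pElem k H) (LinearMap.lTensor H antipode (comul h)) = pElem k H * (h ⊗ₜ 1) := by
  have h1 : ∀ (y : H ⊗[k] (H ⊗[k] H)) (w : H ⊗[k] H),
      comulMul (betaRight k H y) (LinearMap.lTensor H antipode w) =
        betaRight k H (Algebra.TensorProduct.assoc k k k H H H
          (Algebra.TensorProduct.map comul (AlgHom.id k H) w) * y) := by
    intro y w
    induction w using TensorProduct.induction_on with
    | zero => simp
    | add u v hu hv => simp only [map_add, add_mul, hu, hv]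
    | tmul a b => simp [betaRight_assoc_mul]
  -- Quasi-coassociativity turns `(Δ ⊗ id)(Δ(h)) Φ⁻¹` into `Φ⁻¹ (id ⊗ Δ)(Δ(h))`, where the axiom for
  -- `β` absorbs the inner `Δ`.
  have h2 := quasi_coassoc (k := k) h
  rw [mul_assoc, ← Units.inv_mul_eq_iff_eq_mul] at h2
  rw [pElem, h1, ← h2, betaRight_mul_comul, id_tensor_counit]

/-- This and the next two lemmas evaluate `betaAlphaRight` on the factors of the cocycle identity,
solved for `(Δ ⊗ id ⊗ id)(Φ) (Φ⁻¹ ⊗ 1)`. Here the expression in `p` and `q` appears; in the other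
two the axioms for `α` and `β` remove a comultiplication. -/
lemma betaAlphaRight_comul_left (z y : H ⊗[k] (H ⊗[k] H)) :
    betaAlphaRight k H (Algebra.TensorProduct.assoc k k k H H (H ⊗[k] H)
        (Algebra.TensorProduct.map comul (AlgHom.id k (H ⊗[k] H)) z) * tmulOne y) =
      comulMul (betaRight k H y) (alphaRight k H z) := by
  have key : ∀ (d : H ⊗[k] H) (b c : H),
      betaAlphaRight k H (Algebra.TensorProduct.assoc k k k H H (H ⊗[k] H)
        (d ⊗ₜ (b ⊗ₜ c)) * tmulOne y) =
      d * betaRight k H y * (1 ⊗ₜ (antipode (k := k) b * α k * c)) := by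
    intro d b c
    induction d using TensorProduct.induction_on with
    | zero => simp
    | add u v hu hv => simp only [TensorProduct.add_tmul, map_add, add_mul, hu, hv]
    | tmul d e =>
    induction y using TensorProduct.induction_on with
    | zero => simp
    | add u v hu hv => simp only [map_add, add_mul, mul_add, hu, hv]
    | tmul a w =>
    induction w using TensorProduct.induction_on with
    | zero => simp
    | add u v hu hv => simp only [TensorProduct.tmul_add, map_add, add_mul, mul_add, hu, hv]
    | tmul u v => simp [tmulOne_tmul, antipode_mul, mul_assoc]
  induction z using TensorProduct.induction_on with
  | zero => simp
  | add u v hu hv => simp only [map_add, add_mul, hu, hv]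
  | tmul a w =>
  induction w using TensorProduct.induction_on with
  | zero => simp
  | add u v hu hv => simp only [TensorProduct.tmul_add, map_add, add_mul, hu, hv]
  | tmul b c => simpa using key (comul a) b c

lemma betaAlphaRight_comul_right_mul (w : H ⊗[k] (H ⊗[k] H)) (z : H ⊗[k] (H ⊗[k] (H ⊗[k] H))) :
    betaAlphaRight k H (Algebra.TensorProduct.map (AlgHom.id k H)
        (Algebra.TensorProduct.map (AlgHom.id k H) comul) w * z) =
      counitRight k H w * betaAlphaRight k H z := by
  induction w using TensorProduct.induction_on with
  | zero => simp
  | add u v hu hv => simp only [map_add, add_mul, hu, hv]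
  | tmul a w =>
  induction w using TensorProduct.induction_on with
  | zero => simp
  | add u v hu hv => simp only [TensorProduct.tmul_add, map_add, add_mul, hu, hv]
  | tmul b c =>
  induction z using TensorProduct.induction_on with
  | zero => simp
  | add u v hu hv => simp only [map_add, mul_add, hu, hv]
  | tmul a' z =>
  induction z using TensorProduct.induction_on with
  | zero => simp
  | add u v hu hv => simp only [TensorProduct.tmul_add, map_add, mul_add, hu, hv]
  | tmul b' z => simp [sandwich_alpha_comul_mul, mul_assoc, TensorProduct.tmul_smul]

lemma betaAlphaRight_one_tmul_mul (w y : H ⊗[k] (H ⊗[k] H)) :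
    betaAlphaRight k H ((Algebra.TensorProduct.includeRight :
        H ⊗[k] (H ⊗[k] H) →ₐ[k] H ⊗[k] (H ⊗[k] (H ⊗[k] H))) w * Algebra.TensorProduct.map (AlgHom.id k H)
        ((Algebra.TensorProduct.assoc k k k H H H).toAlgHom.comp
          (Algebra.TensorProduct.map comul (AlgHom.id k H))) y) =
      (Algebra.TensorProduct.includeRight : H →ₐ[k] H ⊗[k] H)
        (sandwich₃ LinearMap.id (β k) antipode (α k) LinearMap.id w) *
        Algebra.TensorProduct.map (AlgHom.id k H)
      ((Algebra.TensorProduct.lid k H).toAlgHom.comp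
        (Algebra.TensorProduct.map counit (AlgHom.id k H))) y := by
  have key : ∀ (a b c : H) (d : H ⊗[k] H) (e : H),
      sandwich₃ LinearMap.id (β k) antipode (α k) LinearMap.id ((a ⊗ₜ (b ⊗ₜ c)) *
        (Algebra.TensorProduct.assoc k k k H H H (d ⊗ₜ e))) =
      a * sandwich LinearMap.id (β k) antipode d * (antipode (k := k) b * α k * c * e) := by
    intro a b c d e
    induction d using TensorProduct.induction_on with
    | zero => simp
    | add u v hu hv => simp only [TensorProduct.add_tmul, map_add, mul_add, add_mul, hu, hv]
    | tmul d f => simp [antipode_mul, mul_assoc]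
  induction y using TensorProduct.induction_on with
  | zero => simp
  | add u v hu hv => simp only [map_add, mul_add, hu, hv]
  | tmul a y =>
  induction y using TensorProduct.induction_on with
  | zero => simp
  | add u v hu hv => simp only [TensorProduct.tmul_add, map_add, mul_add, hu, hv]
  | tmul b c =>
  induction w using TensorProduct.induction_on with
  | zero => simp
  | add u v hu hv => simp only [map_add, add_mul, hu, hv]
  | tmul a' w =>
  induction w using TensorProduct.induction_on with
  | zero => simp
  | add u v hu hv => simp only [TensorProduct.tmul_add, map_add, add_mul, hu, hv]
  | tmul b' c' => simp [key, beta_antipode, mul_assoc]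

/-- `Δ(q¹) p (1 ⊗ q²) = 1 ⊗ 1`. -/
lemma comulMul_pElem_qElem : comulMul (pElem k H) (qElem k H) = 1 := by
  have h1 : tmulOne (reassoc : (H ⊗[k] (H ⊗[k] H))ˣ) *
      tmulOne ((reassoc⁻¹ : (H ⊗[k] (H ⊗[k] H))ˣ) : H ⊗[k] (H ⊗[k] H)) = 1 :=
    AlgHom.mul_eq_one_of_mul_eq_one tmulOne (Units.mul_inv _)
  have h2 : Algebra.TensorProduct.map (AlgHom.id k H)
      (Algebra.TensorProduct.map (AlgHom.id k H) (comul (k := k) (H := H)))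
        ((reassoc⁻¹ : (H ⊗[k] (H ⊗[k] H))ˣ) : H ⊗[k] (H ⊗[k] H)) *
      Algebra.TensorProduct.map (AlgHom.id k H)
      (Algebra.TensorProduct.map (AlgHom.id k H) (comul (k := k) (H := H)))
        (reassoc : (H ⊗[k] (H ⊗[k] H))ˣ) = 1 :=
    AlgHom.mul_eq_one_of_mul_eq_one _ (Units.inv_mul _)
  rw [pElem, qElem, ← betaAlphaRight_comul_left]
  -- The cocycle identity now reads `(Δ ⊗ id ⊗ id)(Φ) (Φ⁻¹ ⊗ 1) = (id ⊗ id ⊗ Δ)(Φ⁻¹) (1 ⊗ Φ) (id ⊗ Δ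
  -- ⊗ id)(Φ)`; each factor on the right contributes `1`.
  refine (congrArg (betaAlphaRight k H)
    (mul_eq_of_mul_mul_eq (cocycle (k := k) (H := H)) h1 h2)).trans ?_
  refine (betaAlphaRight_comul_right_mul _ _).trans ?_
  rw [counitRight_reassoc_inv, one_mul]
  refine (betaAlphaRight_one_tmul_mul _ _).trans ?_
  rw [counit_reassoc, reassoc_antipode, ← Algebra.TensorProduct.one_def, mul_one]
  rfl

end QuasiHopfAlgebra

/-- A finite-dimensional algebra is Noetherian, hence Dedekind-finite. -/
lemma Module.Finite.mul_eq_one_symm (k : Type*) {H : Type*} [Field k] [Ring H] [Algebra k H]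
    [Module.Finite k H] {x y : H} (h : x * y = 1) : y * x = 1 := by
  have : IsNoetherianRing H := isNoetherian_of_tower k inferInstance
  exact mul_eq_one_comm.mp h

/-! ### Representations, currying and uncurrying -/

namespace QuasiHopfAlgebra

variable {k H : Type*} [Field k] [Ring H] [Algebra k H]
  {P V M N : Type*} [AddCommGroup P] [Module k P] [AddCommGroup V] [Module k V]
  [AddCommGroup M] [Module k M] [AddCommGroup N] [Module k N]
  (π : H →ₐ[k] Module.End k P) (ν : H →ₐ[k] Module.End k V)
  (μ : H →ₐ[k] Module.End k M) (ρ : H →ₐ[k] Module.End k N)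

/-- The action of `H ⊗ H` on the tensor product of two representations of `H`. -/
noncomputable def tensorAct : H ⊗[k] H →ₐ[k] Module.End k (P ⊗[k] V) :=
  Module.endTensorEndAlgHom.comp (Algebra.TensorProduct.map π ν)

@[simp]
lemma tensorAct_tmul (a b : H) (x : P) (v : V) :
    tensorAct π ν (a ⊗ₜ b) (x ⊗ₜ v) = π a x ⊗ₜ ν b v := rfl

/-- The linear action `(a ⊗ b) φ = μ(a) ∘ φ ∘ ν(b)` of `H ⊗ H` on linear maps. -/
noncomputable def twist : H ⊗[k] H →ₗ[k] Module.End k (V →ₗ[k] M) :=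
  TensorProduct.lift (LinearMap.mk₂ k
    (fun a b => (LinearMap.lcomp k M (ν b)) ∘ₗ ((μ a).compRight k))
    (fun a b c => by ext; simp) (fun a b c => by ext; simp)
    (fun a b c => by ext; simp) (fun a b c => by ext; simp))

@[simp]
lemma twist_tmul (a b : H) (φ : V →ₗ[k] M) (v : V) :
    twist ν μ (a ⊗ₜ b) φ v = μ a (φ (ν b v)) := rfl

lemma comp_twist (f : M →ₗ[k] N) (hf : ∀ h x, f (μ h x) = ρ h (f x)) (w : H ⊗[k] H)
    (φ : V →ₗ[k] M) : f ∘ₗ twist ν μ w φ = twist ν ρ w (f ∘ₗ φ) := by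
  induction w using TensorProduct.induction_on with
  | zero => ext; simp
  | add x y hx hy => simp only [map_add, LinearMap.add_apply, LinearMap.comp_add, hx, hy]
  | tmul a b => ext; simp [hf]

variable [QuasiHopfAlgebra k H]

/-- The action `(a ⊗ b) φ = μ(a) ∘ φ ∘ ν(S(b))` of the algebra `H ⊗ H` on linear maps. -/
noncomputable def homAct : H ⊗[k] H →ₐ[k] Module.End k (V →ₗ[k] M) :=
  Algebra.TensorProduct.algHomOfLinearMapTensorProduct
    (twist ν μ ∘ₗ LinearMap.lTensor H antipode)
    (fun a b c d => by ext; simp [antipode_mul])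
    (by ext; simp [antipode_one])

lemma homAct_apply (w : H ⊗[k] H) :
    homAct ν μ w = twist ν μ (LinearMap.lTensor H antipode w) := rfl

@[simp]
lemma homAct_tmul (a b : H) (φ : V →ₗ[k] M) (v : V) :
    homAct ν μ (a ⊗ₜ b) φ v = μ a (φ (ν (antipode (k := k) b) v)) := rfl

lemma comp_homAct (f : M →ₗ[k] N) (hf : ∀ h x, f (μ h x) = ρ h (f x)) (w : H ⊗[k] H)
    (φ : V →ₗ[k] M) : f ∘ₗ homAct ν μ w φ = homAct ν ρ w (f ∘ₗ φ) :=
  comp_twist ν μ ρ f hf _ φ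

section Curry

variable (g : P ⊗[k] V →ₗ[k] N) (hg : ∀ h x, g (tensorAct π ν (comul h) x) = ρ h (g x))

include hg in
-- Linearity of `g` moves the outer action of `a` inside as `Δ(a)`, so identities for `p` and `q` in
-- `H ⊗ H` become statements about curried maps.
lemma twist_curry (t w : H ⊗[k] H) (x : P) :
    twist ν ρ w (TensorProduct.curry (g ∘ₗ tensorAct π ν t) x) =
      TensorProduct.curry (g ∘ₗ tensorAct π ν (comulMul t w)) x := by
  induction w using TensorProduct.induction_on with
  | zero => ext; simp
  | add u v hu hv =>
    simp only [map_add, LinearMap.add_apply, hu, hv, LinearMap.comp_add]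
    ext; simp
  | tmul a b => ext; simp [← hg]

include hg in
lemma homAct_curry_pElem (h : H) (x : P) :
    homAct ν ρ (comul h) (TensorProduct.curry (g ∘ₗ tensorAct π ν (pElem k H)) x) =
      TensorProduct.curry (g ∘ₗ tensorAct π ν (pElem k H)) (π h x) := by
  rw [homAct_apply, twist_curry π ν ρ g hg, comulMul_pElem]
  ext; simp

include hg in
-- Uncurrying with `q` undoes currying with `p`.
lemma twist_qElem_curry_pElem (x : P) :
    twist ν ρ (qElem k H) (TensorProduct.curry (g ∘ₗ tensorAct π ν (pElem k H)) x) =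
      TensorProduct.curry g x := by
  rw [twist_curry π ν ρ g hg, comulMul_pElem_qElem]
  ext; simp

end Curry

section Uncurry

variable (φ : P →ₗ[k] V →ₗ[k] M)

lemma twist_alphaRight_mul_assoc (y : H ⊗[k] (H ⊗[k] H)) (d : H ⊗[k] H) (b : H)
    (ξ : V →ₗ[k] M) (v : V) :
    twist ν μ (alphaRight k H (y * Algebra.TensorProduct.assoc k k k H H H (d ⊗ₜ b))) ξ v =
      twist ν μ (alphaRight k H y) (homAct ν μ d ξ) (ν b v) := by
  induction d using TensorProduct.induction_on with
  | zero => simp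
  | add u v hu hv =>
    simp only [TensorProduct.add_tmul, map_add, mul_add, LinearMap.add_apply, hu, hv]
  | tmul d e =>
  induction y using TensorProduct.induction_on with
  | zero => simp
  | add u v hu hv => simp only [map_add, add_mul, LinearMap.add_apply, hu, hv]
  | tmul a w => simp [sandwich_alpha_mul_tmul]

/-- The map `x ⊗ v ↦ X¹ φ(x)(S(X²) α X³ v)`. -/
noncomputable def uncurryHom : P ⊗[k] V →ₗ[k] M :=
  TensorProduct.lift (twist ν μ (qElem k H) ∘ₗ φ)

@[simp]
lemma uncurryHom_tmul (x : P) (v : V) :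
    uncurryHom ν μ φ (x ⊗ₜ v) = twist ν μ (qElem k H) (φ x) v := rfl

/-- Linearity of `φ` brings in `Φ (Δ ⊗ id)(Δ(h)) = (id ⊗ Δ)(Δ(h)) Φ`; the axiom for `α` then leaves
`h` acting on the outside. -/
lemma uncurryHom_comul (hφ : ∀ h x, φ (π h x) = homAct ν μ (comul h) (φ x)) (h : H)
    (z : P ⊗[k] V) :
    uncurryHom ν μ φ (tensorAct π ν (comul h) z) = μ h (uncurryHom ν μ φ z) := by
  induction z using TensorProduct.induction_on with
  | zero => simp
  | add x y hx hy => simp only [map_add, hx, hy]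
  | tmul x v =>
  have h1 : ∀ w : H ⊗[k] H, uncurryHom ν μ φ (tensorAct π ν w (x ⊗ₜ v)) =
      twist ν μ (alphaRight k H ((reassoc : (H ⊗[k] (H ⊗[k] H))ˣ) *
        Algebra.TensorProduct.assoc k k k H H H
          (Algebra.TensorProduct.map comul (AlgHom.id k H) w))) (φ x) v := by
    intro w
    induction w using TensorProduct.induction_on with
    | zero => simp
    | add a b ha hb => simp only [map_add, mul_add, LinearMap.add_apply, ha, hb]
    | tmul a b => simp [hφ, twist_alphaRight_mul_assoc, qElem]
  have h2 : ∀ w : H ⊗[k] H, twist ν μ ((h ⊗ₜ 1) * w) (φ x) v = μ h (twist ν μ w (φ x) v) := by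
    intro w
    induction w using TensorProduct.induction_on with
    | zero => simp
    | add a b ha hb => simp only [map_add, mul_add, LinearMap.add_apply, ha, hb]
    | tmul a b => simp
  have h3 := quasi_coassoc (k := k) h
  rw [Units.eq_mul_inv_iff_mul_eq] at h3
  rw [h1, ← h3, alphaRight_comul_mul, id_tensor_counit, h2, uncurryHom_tmul, qElem]

end Uncurry

end QuasiHopfAlgebra

/-- The lifting property of a projective module, for representations given by algebra maps. -/
lemma Module.Projective.exists_lift_of_algHom {k H P M N : Type*} [Field k] [Ring H] [Algebra k H]
    [AddCommGroup P] [Module k P] [Module H P] [IsScalarTower k H P] [Module.Projective H P]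
    [AddCommGroup M] [Module k M] [AddCommGroup N] [Module k N]
    (μ : H →ₐ[k] Module.End k M) (ρ : H →ₐ[k] Module.End k N)
    (f : M →ₗ[k] N) (hf : ∀ h x, f (μ h x) = ρ h (f x)) (hsurj : Function.Surjective f)
    (φ : P →ₗ[k] N) (hφ : ∀ (h : H) x, φ (h • x) = ρ h (φ x)) :
    ∃ ψ : P →ₗ[k] M, (∀ (h : H) x, ψ (h • x) = μ h (ψ x)) ∧ f ∘ₗ ψ = φ := by
  let _ : Module H M := Module.compHom M μ.toRingHom
  let _ : Module H N := Module.compHom N ρ.toRingHom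
  have hM : ∀ (h : H) (x : M), h • x = μ h x := fun _ _ => rfl
  have hN : ∀ (h : H) (x : N), h • x = ρ h x := fun _ _ => rfl
  have : IsScalarTower k H M := ⟨fun c h x => by simp [hM]⟩
  let f' : M →ₗ[H] N := { f with map_smul' := hf }
  let φ' : P →ₗ[H] N := { φ with map_smul' := hφ }
  obtain ⟨ψ, hψ⟩ := Module.projective_lifting_property f' φ' hsurj
  refine ⟨ψ.restrictScalars k, fun h x => ψ.map_smul h x, ?_⟩
  ext x
  exact LinearMap.congr_fun hψ x

/-! ### Integrals from projective modules, and Maschke's theorem -/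

namespace QuasiHopfAlgebra

variable (k H : Type*) [Field k] [Ring H] [Algebra k H] [QuasiHopfAlgebra k H]

/-- The trivial representation of `H`. -/
noncomputable def trivialRep : H →ₐ[k] Module.End k k := (Algebra.lmul k k).comp counit

@[simp]
lemma trivialRep_apply (h : H) (c : k) : trivialRep k H h c = counit h * c := rfl

variable {k H}

section Involutory

lemma IsInvolutory.antipode_beta_mul_alpha_mul (hinv : IsInvolutory k H) :
    antipode (k := k) (β k : H) * α k * (β k * antipode (k := k) (α k : H)) = 1 := by
  have h := hinv 1
  rw [antipode_one, antipode_one] at h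
  simpa [mul_assoc] using h.symm

variable [Module.Finite k H]

lemma IsInvolutory.antipode_antipode_mul (hinv : IsInvolutory k H) (h : H) :
    antipode (k := k) (antipode (k := k) h) * (antipode (k := k) (β k : H) * α k) =
      antipode (k := k) (β k : H) * α k * h := by
  have h1 := Module.Finite.mul_eq_one_symm k hinv.antipode_beta_mul_alpha_mul
  rw [hinv h, mul_assoc _ (β k) (antipode (α k)), mul_assoc _ (β k * antipode (α k)), h1, mul_one]

/-- Involutivity at `1` gives `S(β) α β S(α) = 1`; exchanging the factors of a product equal to `1`
twice permutes this cyclically. -/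
lemma IsInvolutory.antipode_alpha_mul_mul_beta (hinv : IsInvolutory k H) :
    antipode (k := k) (α k : H) * (antipode (k := k) (β k : H) * α k) * β k = 1 := by
  have h1 := hinv.antipode_beta_mul_alpha_mul
  have h2 : (β k * antipode (k := k) (α k : H)) * (antipode (k := k) (β k : H) * α k) = 1 :=
    Module.Finite.mul_eq_one_symm k h1
  apply Module.Finite.mul_eq_one_symm k
  simpa only [mul_assoc] using h2

end Involutory

section Integral

variable [Module.Finite k H] {P : Type*} [AddCommGroup P] [Module k P] [Module H P]
  [IsScalarTower k H P] [Module.Finite k P]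

lemma exists_integral_of_projective [Module.Projective H P] (hinv : IsInvolutory k H) :
    ∃ t : H, (∀ h : H, h * t = counit (k := k) h • t) ∧
      counit (k := k) t = (Module.finrank k P : k) := by
  let π : H →ₐ[k] Module.End k P := Algebra.lsmul k k P
  let ν : H →ₐ[k] Module.End k (Module.Dual k P) := AlgHom.ofLinearMap
    ((homAct π (trivialRep k H)).toLinearMap ∘ₗ TensorProduct.mk k H H 1)
    (by ext; simp [antipode_one]) (fun x y => by ext; simp [antipode_mul])
  have hν : ∀ h f x, ν h f x = f (antipode (k := k) h • x) := fun h f x => by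
    change homAct π (trivialRep k H) (1 ⊗ₜ h) f x = _
    rw [homAct_tmul, map_one]; rfl
  -- With this `u` the trace form is invariant: `S(h₂) u h₁ = S(S(h₁) α h₂) S(β) α = ε(h) u`, since
  -- `S(β) α h₁ = S²(h₁) S(β) α`. It also satisfies `u β = 1`.
  set u : H := antipode (k := k) (α k : H) * (antipode (k := k) (β k : H) * α k) with hu
  let θ : P ⊗[k] Module.Dual k P →ₗ[k] Module.End k P :=
    dualTensorHom k P P ∘ₗ (TensorProduct.comm k P (Module.Dual k P)).toLinearMap
  have hθ : ∀ x f y, θ (x ⊗ₜ f) y = f y • x := fun x f y => rfl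
  let g : P ⊗[k] Module.Dual k P →ₗ[k] k :=
    LinearMap.trace k P ∘ₗ LinearMap.mulLeft k (π u) ∘ₗ θ
  have hgθ : ∀ z, g z = LinearMap.trace k P (π u * θ z) := fun z => rfl
  have hgt : ∀ x f, g (x ⊗ₜ f) = f (u • x) := fun x f => by
    have : π u * θ (x ⊗ₜ f) = dualTensorHom k P P (f ⊗ₜ (u • x)) := by
      ext y
      simp [hθ, π]
    rw [hgθ, this, LinearMap.trace_eq_contract_apply, contractLeft_apply]
  have hg : ∀ h z, g (tensorAct π ν (comul h) z) = trivialRep k H h (g z) := by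
    intro h z
    induction z using TensorProduct.induction_on with
    | zero => simp
    | add x y hx hy => simp only [map_add, hx, hy]
    | tmul x f =>
    have key : ∀ w : H ⊗[k] H, g (tensorAct π ν w (x ⊗ₜ f)) =
        f ((antipode (k := k) (sandwich antipode (α k) LinearMap.id w) *
          (antipode (k := k) (β k : H) * α k)) • x) := by
      intro w
      induction w using TensorProduct.induction_on with
      | zero => simp
      | add a b ha hb => simp only [map_add, LinearMap.add_apply, add_mul, add_smul, ha, hb]
      | tmul a b =>
        rw [tensorAct_tmul, hgt, hν]
        congr 1
        simp only [π, Algebra.lsmul_coe, ← mul_smul, sandwich_tmul, antipode_mul, hu,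
          LinearMap.id_apply]
        simp only [mul_assoc, hinv.antipode_antipode_mul]
    rw [key, antipode_alpha, hgt, trivialRep_apply, LinearMap.map_smul, smul_mul_assoc, smul_assoc,
      LinearMap.map_smul, smul_eq_mul, hu]
  let σ : H →ₗ[k] k := (counit (k := k) (H := H)).toLinearMap
  have hσ : ∀ h x, σ (Algebra.lmul k H h x) = trivialRep k H h (σ x) := fun h x => by
    simp [σ]
  -- The curried trace form is lifted along `Hom(P*, H) → Hom(P*, k)`, composition with `ε`, which
  -- is onto because `ε` has the `k`-linear section `c ↦ c · 1`.
  obtain ⟨φ, hφ, hφσ⟩ := Module.Projective.exists_lift_of_algHom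
    ((homAct ν (Algebra.lmul k H)).comp comul) ((homAct ν (trivialRep k H)).comp comul)
    (σ.compRight k) (fun h ξ => comp_homAct ν _ _ σ hσ _ ξ)
    (fun ξ => ⟨(Algebra.linearMap k H) ∘ₗ ξ, by ext; simp [σ]⟩)
    (TensorProduct.curry (g ∘ₗ tensorAct π ν (pElem k H)))
    (fun h x => (homAct_curry_pElem π ν _ g hg h x).symm)
  have hψ := uncurryHom_comul π ν (Algebra.lmul k H) φ hφ
  have hσψ : ∀ z, σ (uncurryHom ν (Algebra.lmul k H) φ z) = g z := by
    intro z
    induction z using TensorProduct.induction_on with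
    | zero => simp
    | add x y hx hy => simp only [map_add, hx, hy]
    | tmul x f =>
    rw [uncurryHom_tmul, ← LinearMap.comp_apply, comp_twist ν _ _ σ hσ]
    have h1 : σ ∘ₗ φ x = TensorProduct.curry (g ∘ₗ tensorAct π ν (pElem k H)) x :=
      LinearMap.congr_fun hφσ x
    rw [h1, twist_qElem_curry_pElem π ν _ g hg, TensorProduct.curry_apply]
  have hbij : Function.Bijective θ :=
    (dualTensorHom_bijective (R := k) (M := P) (N := P)).comp
      (TensorProduct.comm k P (Module.Dual k P)).bijective
  -- This is the coevaluation element; its invariance is `h₁ β S(h₂) = ε(h) β` read in `End P`.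
  obtain ⟨z, hz⟩ := hbij.2 (π (β k))
  have hzθ : ∀ w : H ⊗[k] H, ∀ y,
      θ (tensorAct π ν w y) = twist π π (LinearMap.lTensor H antipode w) (θ y) := by
    intro w y
    induction w using TensorProduct.induction_on with
    | zero => simp
    | add a b ha hb => simp only [map_add, LinearMap.add_apply, ha, hb]
    | tmul a b =>
    induction y using TensorProduct.induction_on with
    | zero => simp
    | add x y hx hy => simp only [map_add, hx, hy]
    | tmul x f => ext y; simp [hθ, hν, π]
  have hinvz : ∀ h : H, tensorAct π ν (comul h) z = counit (k := k) h • z := by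
    intro h
    apply hbij.1
    have key : ∀ w : H ⊗[k] H, twist π π (LinearMap.lTensor H antipode w) (π (β k)) =
        π (sandwich LinearMap.id (β k) antipode w) := by
      intro w
      induction w using TensorProduct.induction_on with
      | zero => simp
      | add a b ha hb => simp only [map_add, LinearMap.add_apply, ha, hb]
      | tmul a b => ext x; simp [π]
    rw [hzθ, hz, key, beta_antipode, map_smul, map_smul, hz]
  refine ⟨uncurryHom ν (Algebra.lmul k H) φ z, fun h => ?_, ?_⟩
  · have := hψ h z
    rw [hinvz, map_smul] at this
    exact this.symm
  · change σ _ = _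
    rw [hσψ, hgθ, hz, ← map_mul, hu, hinv.antipode_alpha_mul_mul_beta, map_one,
      LinearMap.trace_one]

end Integral

/-- Maschke's theorem for quasi-Hopf algebras. -/
lemma isSemisimpleRing_of_integral (t : H) (ht : ∀ h : H, h * t = counit (k := k) h • t)
    (ht1 : counit (k := k) t = 1) : IsSemisimpleRing H := by
  refine (isSemisimpleModule_iff H H).mpr ⟨fun L => ?_⟩
  obtain ⟨r, hr⟩ := (L.restrictScalars k).subtype.exists_leftInverse_of_injective
    (LinearMap.ker_eq_bot.mpr Subtype.val_injective)
  let r' : H →ₗ[k] H := (L.restrictScalars k).subtype ∘ₗ r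
  have hr1 : ∀ x, r' x ∈ L := fun x => (r x).2
  have hr2 : ∀ x ∈ L, r' x = x := fun x hx =>
    congrArg Subtype.val (LinearMap.congr_fun hr (⟨x, hx⟩ : L.restrictScalars k))
  let ℓ : H →ₐ[k] Module.End k H := Algebra.lmul k H
  -- Averaging a `k`-linear projection onto `L` over `t` gives an invariant of `Hom(H, H)`. The
  -- factor `β` makes the average act on `L` as `t₁ β S(t₂) = ε(t) β = β`.
  let φ₀ : H →ₗ[k] H := homAct ℓ ℓ (comul t) (r' ∘ₗ LinearMap.mulLeft k (β k))
  let φ : k →ₗ[k] H →ₗ[k] H := LinearMap.toSpanSingleton k _ φ₀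
  have hφ : ∀ h c, φ (trivialRep k H h c) = homAct ℓ ℓ (comul h) (φ c) := fun h c => by
    simp only [φ, φ₀, LinearMap.toSpanSingleton_apply, map_smul, trivialRep_apply]
    rw [← Module.End.mul_apply, ← map_mul, ← map_mul, ht, map_smul, map_smul, LinearMap.smul_apply,
      smul_smul, mul_comm]
  -- Through `k ⊗ H ≅ H` this is `v ↦ X¹ φ₀(S(X²) α X³ v)`, which is `H`-linear; on `L` it is
  -- multiplication by `X¹ β S(X²) α X³ = 1`.
  let ψ := uncurryHom ℓ ℓ φ
  have hψ : ∀ h v, ψ (1 ⊗ₜ (h * v)) = h * ψ (1 ⊗ₜ v) := fun h v => by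
    have h1 : ∀ w : H ⊗[k] H, tensorAct (trivialRep k H) ℓ w (1 ⊗ₜ v) =
        1 ⊗ₜ (Algebra.TensorProduct.lid k H
          (Algebra.TensorProduct.map counit (AlgHom.id k H) w) * v) := by
      intro w
      induction w using TensorProduct.induction_on with
      | zero => simp
      | add a b ha hb =>
        simp only [map_add, LinearMap.add_apply, add_mul, TensorProduct.tmul_add, ha, hb]
      | tmul a b => simp [ℓ, TensorProduct.tmul_smul, TensorProduct.smul_tmul']
    have h2 := uncurryHom_comul (trivialRep k H) ℓ ℓ φ hφ h (1 ⊗ₜ v)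
    rwa [h1, counit_tensor_id] at h2
  have htwist_mem : ∀ (w : H ⊗[k] H) (ξ : H →ₗ[k] H), (∀ x, ξ x ∈ L) →
      ∀ x, twist ℓ ℓ w ξ x ∈ L := by
    intro w ξ hξ x
    induction w using TensorProduct.induction_on with
    | zero => simp
    | add a b ha hb => simpa only [map_add, LinearMap.add_apply] using L.add_mem ha hb
    | tmul a b => exact L.smul_mem a (hξ _)
  have hψ_mem : ∀ v, ψ (1 ⊗ₜ v) ∈ L := fun v => by
    have h1 : φ 1 = φ₀ := by simp [φ]
    rw [uncurryHom_tmul, h1]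
    refine htwist_mem _ _ (fun x => ?_) v
    change homAct ℓ ℓ (comul t) _ x ∈ L
    rw [homAct_apply]
    exact htwist_mem _ (r' ∘ₗ LinearMap.mulLeft k (β k)) (fun x => hr1 _) x
  have hφ₀ : ∀ v ∈ L, φ₀ v = β k * v := fun v hv => by
    have key : ∀ w : H ⊗[k] H, homAct ℓ ℓ w (r' ∘ₗ LinearMap.mulLeft k (β k)) v =
        sandwich LinearMap.id (β k) antipode w * v := by
      intro w
      induction w using TensorProduct.induction_on with
      | zero => simp
      | add a b ha hb => simp only [map_add, LinearMap.add_apply, add_mul, ha, hb]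
      | tmul a b =>
        have h2 : r' (β k * (antipode (k := k) b * v)) = β k * (antipode (k := k) b * v) :=
          hr2 _ (L.smul_mem (β k) (L.smul_mem (antipode (k := k) b) hv))
        simp [ℓ, h2, mul_assoc]
    rw [key, beta_antipode, ht1, one_smul]
  have hψ_id : ∀ v ∈ L, ψ (1 ⊗ₜ v) = v := fun v hv => by
    have key : ∀ y : H ⊗[k] (H ⊗[k] H), twist ℓ ℓ (alphaRight k H y) φ₀ v =
        sandwich₃ LinearMap.id (β k) antipode (α k) LinearMap.id y * v := by
      intro y
      induction y using TensorProduct.induction_on with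
      | zero => simp
      | add a b ha hb => simp only [map_add, LinearMap.add_apply, add_mul, ha, hb]
      | tmul a w =>
      have h2 : φ₀ (sandwich antipode (α k) LinearMap.id w * v) = _ :=
        hφ₀ _ (L.smul_mem (sandwich antipode (α k) LinearMap.id w) hv)
      simp [ℓ, h2, mul_assoc]
    have h1 : φ 1 = φ₀ := by simp [φ]
    rw [uncurryHom_tmul, h1, qElem, key, reassoc_antipode, one_mul]
  let e : H →ₗ[H] L :=
    { toFun := fun v => ⟨ψ (1 ⊗ₜ v), hψ_mem v⟩
      map_add' := fun x y => Subtype.ext (by simp [TensorProduct.tmul_add])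
      map_smul' := fun h x => Subtype.ext (hψ h x) }
  exact ⟨_, LinearMap.isCompl_of_proj (f := e) fun x => Subtype.ext (hψ_id x x.2)⟩

end QuasiHopfAlgebra

theorem mainTheorem3 (k H : Type*) [Field k] [Ring H] [Algebra k H] [QuasiHopfAlgebra k H]
    [Module.Finite k H] (hinv : QuasiHopfAlgebra.IsInvolutory k H)
    (hss : ¬ IsSemisimpleRing H) (p : ℕ) [CharP k p]
    (P : Type*) [AddCommGroup P] [Module k P] [Module H P] [IsScalarTower k H P]
    [Module.Finite k P] [Module.Projective H P] :
    p ∣ Module.finrank k P := by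
  rw [← CharP.cast_eq_zero_iff k p]
  by_contra hne
  obtain ⟨t, ht, htd⟩ := exists_integral_of_projective (k := k) (P := P) hinv
  -- Dividing by `dim P`, nonzero in `k`, normalizes the counit of the integral to `1`.
  refine hss (isSemisimpleRing_of_integral (k := k) ((Module.finrank k P : k)⁻¹ • t)
    (fun h => ?_) ?_)
  · rw [mul_smul_comm, ht, smul_comm]
  · rw [map_smul, htd, smul_eq_mul, inv_mul_cancel₀ hne]
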